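/- Let $\rho$ be a three-qubit positive-partial-transpose entangled state (PPTES) of rank four: $\rho$ is a positive semidefinite operator on $\mathbb{C}^2\otimes\mathbb{C}^2\otimes\mathbb{C}^2$ of rank four, all of its partial transposes (with respect to every subset of the qubits) are positive semidefinite, and $\rho$ is not fully separable. (No normalization of the trace is needed.) Suppose that, after some relabelling $A_1,A_2,A_3$ of the three qubits, $\rho$ is written as $$\rho=\sum_{i=1}^4|\alpha_i\rangle\langle\alpha_i|_{A_1}\otimes|\psi_i\rangle\langle\psi_i|_{A_2A_3},$$ where any two of the vectors $\alpha_1,\dots,\alpha_4\in\mathbb{C}^2$ are linearly independent and $\psi_1,\dots,\psi_4\in\mathbb{C}^2\otimes\mathbb{C}^2$ are linearly independent and entangled (i.e. none of them is a product vector $b\otimes c$). Let $$I_\rho=\operatorname{Tr}\left(\rho^T\epsilon_3\,\rho\,\epsilon_3\right),\qquad \epsilon_3=\epsilon\otimes\epsilon\otimes\epsilon,\qquad \epsilon=\begin{pmatrix}0&1\\-1&0\end{pmatrix},$$ be the Lorentz invariant of $\rho$. Then $I_\rho=0$ (that is, $\rho$ is of type II) if and only if there are invertible matrices $P,Q\in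 M_2(\mathbb{C})$ and an invertible diagonal matrix $D\in M_4(\mathbb{C})$ such that $$(P\otimes Q)\,(\psi_1,\psi_2,\psi_3,\psi_4)\,D=\begin{pmatrix}1&1&0&0\\0&0&1&1\\0&0&1&-1\\1&-1&0&0\end{pmatrix},$$ where $(\psi_1,\psi_2,\psi_3,\psi_4)$ is the $4\times4$ matrix with columns $\psi_i$ and the basis of $\mathbb{C}^2\otimes\mathbb{C}^2$ is ordered as $00,01,10,11$. -/

import Mathlib

open scoped Kronecker ComplexOrder

/-- Operators on `n` qubits as matrices; the computational basis of `(ℂ²)^{⊗n}` is indexed by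
`Fin n → Fin 2`, the value at `k` being the basis label of the `k`-th qubit. -/
abbrev QubitMatrix (n : ℕ) : Type := Matrix (Fin n → Fin 2) (Fin n → Fin 2) ℂ

/-- The product vector `x₁ ⊗ ⋯ ⊗ xₙ`. -/
def productVector {n : ℕ} (x : Fin n → Fin 2 → ℂ) : (Fin n → Fin 2) → ℂ :=
  fun s => ∏ k, x k (s k)

/-- The operator `|v⟩⟨v|`. -/
def ketBra {ι : Type*} (v : ι → ℂ) : Matrix ι ι ℂ := Matrix.vecMulVec v (star v)

/-- Full separability: `ρ = ∑ pᵢ |zᵢ⟩⟨zᵢ|` with `pᵢ ≥ 0` and `zᵢ` a tensor product of unit vectors.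
As `Tr ρ = ∑ pᵢ`, for a normalized state this is a convex combination of pure product states. -/
def IsFullySeparable {n : ℕ} (ρ : QubitMatrix n) : Prop :=
  ∃ (m : ℕ) (p : Fin m → ℝ) (x : Fin m → Fin n → Fin 2 → ℂ),
    (∀ i, 0 ≤ p i) ∧ (∀ i k, ∑ a, ‖x i k a‖ ^ 2 = 1) ∧
      ρ = ∑ i, (p i : ℂ) • ketBra (productVector (x i))

/-- The partial transpose of `ρ` with respect to the qubits in `S`. -/
def partialTranspose {n : ℕ} (S : Finset (Fin n)) (ρ : QubitMatrix n) : QubitMatrix n :=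
  Matrix.of fun s t =>
    ρ (fun k => if k ∈ S then t k else s k) (fun k => if k ∈ S then s k else t k)

/-- A (not necessarily normalized) `n`-qubit PPT entangled state: a positive semidefinite
operator all of whose partial transposes are positive semidefinite and which is not separable. -/
structure IsPPTEntangled {n : ℕ} (ρ : QubitMatrix n) : Prop where
  posSemidef : ρ.PosSemidef
  ppt : ∀ S : Finset (Fin n), (partialTranspose S ρ).PosSemidef
  entangled : ¬ IsFullySeparable ρ

/-- The two-dimensional Levi-Civita symbol. -/
def leviCivita : Matrix (Fin 2) (Fin 2) ℂ := !![0, 1; -1, 0]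

/-- The `n`-fold tensor power of the Levi-Civita symbol. -/
def leviCivitaPow (n : ℕ) : QubitMatrix n :=
  Matrix.of fun s t => ∏ k, leviCivita (s k) (t k)

/-- The Lorentz invariant `Tr (ρᵀ εₙ ρ εₙ)`. -/
def lorentzInvariant {n : ℕ} (ρ : QubitMatrix n) : ℂ :=
  (ρ.transpose * leviCivitaPow n * ρ * leviCivitaPow n).trace

/-- A two-qubit vector is entangled if it is not of the form `b ⊗ c`. -/
def IsEntangledVector (ψ : Fin 2 × Fin 2 → ℂ) : Prop :=
  ¬ ∃ b c : Fin 2 → ℂ, ∀ s, ψ s = b s.1 * c s.2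

/-- The identification of the three-qubit basis with the basis of `ℂ² ⊗ (ℂ² ⊗ ℂ²)` in which the
three factors are the qubits `π 0`, `π 1`, `π 2`. -/
def splitQubits (π : Equiv.Perm (Fin 3)) (s : Fin 3 → Fin 2) : Fin 2 × (Fin 2 × Fin 2) :=
  (s (π 0), (s (π 1), s (π 2)))

/-- `∑ᵢ |αᵢ⟩⟨αᵢ| ⊗ |ψᵢ⟩⟨ψᵢ|`, with `αᵢ` on qubit `π 0` and `ψᵢ` on qubits `π 1`, `π 2`. -/
def biproductSum (π : Equiv.Perm (Fin 3)) (α : Fin 4 → Fin 2 → ℂ)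
    (ψ : Fin 4 → Fin 2 × Fin 2 → ℂ) : QubitMatrix 3 :=
  ∑ i, (ketBra (α i) ⊗ₖ ketBra (ψ i)).submatrix (splitQubits π) (splitQubits π)

/-- The matrix with columns `ψ₁, ψ₂, ψ₃, ψ₄`. -/
def columnMatrix (ψ : Fin 4 → Fin 2 × Fin 2 → ℂ) : Matrix (Fin 2 × Fin 2) (Fin 4) ℂ :=
  Matrix.of fun s j => ψ j s

/-- The Bell matrix (columns: unnormalized Bell states). The rows are in the order
`00, 01, 10, 11`, that is, `finProdFinEquiv (a, b) = 2 a + b`. -/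
def bellMatrix : Matrix (Fin 2 × Fin 2) (Fin 4) ℂ :=
  (!![1,  1, 0,  0;
      0,  0, 1,  1;
      0,  0, 1, -1;
      1, -1, 0,  0] : Matrix (Fin (2 * 2)) (Fin 4) ℂ).submatrix finProdFinEquiv id

open Matrix

/-! Since `ε₃` is real and skew, each pair of terms of `ρ` contributes `-|⟨vᵢ, ε₃ vⱼ⟩|²` (bilinear
pairing, `vᵢ = αᵢ ⊗ ψᵢ`) to the invariant. The pairing factors as `det (αᵢ, αⱼ)` times `polarDet
(ψᵢ) (ψⱼ)`. All terms have one sign and the first factor is nonzero for `i ≠ j`, so the invariant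
vanishes iff the `ψᵢ` are pairwise orthogonal for `polarDet`.

Read as `2 × 2` matrices, the entangled `ψᵢ` are invertible, and `P ⊗ Q` acts by `M ↦ P M Qᵀ`,
scaling the form by `det P * det Q`. The Bell matrices are pairwise orthogonal, which gives one
direction; `exists_equivalent_bell` gives the other. -/

/-- The symmetric bilinear form `⟨v, (ε ⊗ ε) w⟩`, the polarization of the determinant. -/
def polarDet (v w : Fin 2 × Fin 2 → ℂ) : ℂ :=
  v (0, 0) * w (1, 1) + v (1, 1) * w (0, 0) - v (0, 1) * w (1, 0) - v (1, 0) * w (0, 1)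

theorem ketBra_kronecker {ι κ : Type*} (a : ι → ℂ) (p : κ → ℂ) :
    ketBra a ⊗ₖ ketBra p = ketBra (fun x : ι × κ => a x.1 * p x.2) := by
  ext i j
  simp [ketBra, vecMulVec_apply]
  ring

/-- The trace of a product of two rank-one matrices is a product of two scalars; for `J` real and
skew, one is minus the conjugate of the other. -/
theorem trace_ketBra_transpose_mul {ι : Type*} [Fintype ι] (J : Matrix ι ι ℂ)
    (hskew : Jᵀ = -J) (hreal : Jᴴ = Jᵀ) (v w : ι → ℂ) :
    ((ketBra v)ᵀ * J * ketBra w * J).trace = -((‖v ⬝ᵥ J *ᵥ w‖ ^ 2 : ℝ) : ℂ) := by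
  have h1 : (ketBra v)ᵀ * J * ketBra w * J
      = vecMulVec (star v) (v ᵥ* J) * vecMulVec w (star w ᵥ* J) := by
    rw [ketBra, ketBra, transpose_vecMulVec, vecMulVec_mul, Matrix.mul_assoc,
      vecMulVec_mul w]
  have h2 : star w ᵥ* J ⬝ᵥ star v = -star (v ⬝ᵥ J *ᵥ w) := by
    have hJ : J = -Jᴴ := by rw [hreal, hskew, neg_neg]
    conv_lhs => rw [hJ]
    rw [vecMul_neg, neg_dotProduct, ← star_mulVec, star_dotProduct_star]
  rw [h1, vecMulVec_mul_vecMulVec, trace_vecMulVec, dotProduct_smul, dotProduct_comm (star v), h2,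
    ← dotProduct_mulVec, smul_eq_mul, mul_neg, Complex.star_def, Complex.mul_conj,
    Complex.normSq_eq_norm_sq]

/-- The identification `splitQubits` as an equivalence. -/
def splitQubitsEquiv (π : Equiv.Perm (Fin 3)) : (Fin 3 → Fin 2) ≃ Fin 2 × (Fin 2 × Fin 2) where
  toFun := splitQubits π
  invFun x k := ![x.1, x.2.1, x.2.2] (π.symm k)
  left_inv s := by
    funext k
    obtain ⟨j, rfl⟩ := π.surjective k
    fin_cases j <;> simp [splitQubits]
  right_inv x := by simp [splitQubits]

theorem leviCivitaPow_three (π : Equiv.Perm (Fin 3)) :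
    leviCivitaPow 3 = (leviCivita ⊗ₖ (leviCivita ⊗ₖ leviCivita)).submatrix
      (splitQubitsEquiv π) (splitQubitsEquiv π) := by
  ext s t
  simp only [leviCivitaPow, of_apply, submatrix_apply, kroneckerMap_apply]
  rw [← Equiv.prod_comp π, Fin.prod_univ_three, mul_assoc]
  rfl

theorem dotProduct_leviCivita_kronecker (a b : Fin 2 → ℂ) (v w : Fin 2 × Fin 2 → ℂ) :
    (fun x : Fin 2 × (Fin 2 × Fin 2) => a x.1 * v x.2) ⬝ᵥ
        (leviCivita ⊗ₖ (leviCivita ⊗ₖ leviCivita)) *ᵥ (fun x => b x.1 * w x.2)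
      = (a 0 * b 1 - a 1 * b 0) * polarDet v w := by
  simp [dotProduct, mulVec, Fintype.sum_prod_type, Fin.sum_univ_two, leviCivita, polarDet]
  ring

theorem lorentzInvariant_biproductSum (π : Equiv.Perm (Fin 3)) (α : Fin 4 → Fin 2 → ℂ)
    (ψ : Fin 4 → Fin 2 × Fin 2 → ℂ) :
    lorentzInvariant (biproductSum π α ψ) = -((∑ i, ∑ j,
      ‖(α i 0 * α j 1 - α i 1 * α j 0) * polarDet (ψ i) (ψ j)‖ ^ 2 : ℝ) : ℂ) := by
  set J := leviCivita ⊗ₖ (leviCivita ⊗ₖ leviCivita) with hJ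
  have hskew : Jᵀ = -J := by
    have h : leviCivitaᵀ = -leviCivita := by
      ext i j; fin_cases i <;> fin_cases j <;> simp [leviCivita]
    ext ⟨i, j, k⟩ ⟨i', j', k'⟩
    have h' : ∀ x y, leviCivita y x = -leviCivita x y := fun x y => congrFun₂ h x y
    simp [hJ, h' i i', h' j j', h' k k']
  have hreal : Jᴴ = Jᵀ := by
    have h' : ∀ x y, star (leviCivita x y) = leviCivita x y := by
      intro x y; fin_cases x <;> fin_cases y <;> simp [leviCivita]
    ext ⟨i, j, k⟩ ⟨i', j', k'⟩
    simp only [hJ, conjTranspose_apply, transpose_apply, kroneckerMap_apply, star_mul', h']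
  have hρ : biproductSum π α ψ
      = (∑ i, ketBra (fun x : Fin 2 × (Fin 2 × Fin 2) => α i x.1 * ψ i x.2)).submatrix
        (splitQubitsEquiv π) (splitQubitsEquiv π) := by
    ext s t
    simp only [biproductSum, ketBra_kronecker, Matrix.sum_apply, submatrix_apply]
    rfl
  have htr : ∀ A : Matrix (Fin 2 × (Fin 2 × Fin 2)) (Fin 2 × (Fin 2 × Fin 2)) ℂ,
      (A.submatrix (splitQubitsEquiv π) (splitQubitsEquiv π)).trace = A.trace := fun A =>
    Equiv.sum_comp (splitQubitsEquiv π) (fun x => A x x)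
  rw [lorentzInvariant, hρ, leviCivitaPow_three π, transpose_submatrix, submatrix_mul_equiv,
    submatrix_mul_equiv, submatrix_mul_equiv, htr, ← hJ, transpose_sum]
  simp only [Matrix.sum_mul, Matrix.mul_sum, trace_sum, trace_ketBra_transpose_mul J hskew hreal]
  rw [Finset.sum_comm]
  simp only [hJ, dotProduct_leviCivita_kronecker, Finset.sum_neg_distrib]
  push_cast
  rfl

theorem LinearIndependent.det_pair_ne_zero {a b : Fin 2 → ℂ}
    (h : LinearIndependent ℂ ![a, b]) : a 0 * b 1 - a 1 * b 0 ≠ 0 := by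
  have h' : IsUnit (Matrix.of ![a, b]) := Matrix.linearIndependent_rows_iff_isUnit.mp h
  rw [isUnit_iff_isUnit_det, isUnit_iff_ne_zero, det_fin_two] at h'
  simpa using h'

theorem lorentzInvariant_eq_zero_iff (π : Equiv.Perm (Fin 3)) (α : Fin 4 → Fin 2 → ℂ)
    (ψ : Fin 4 → Fin 2 × Fin 2 → ℂ)
    (hα : ∀ i j, i ≠ j → LinearIndependent ℂ ![α i, α j]) :
    lorentzInvariant (biproductSum π α ψ) = 0 ↔ ∀ i j, i ≠ j → polarDet (ψ i) (ψ j) = 0 := by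
  rw [lorentzInvariant_biproductSum, neg_eq_zero, Complex.ofReal_eq_zero,
    Finset.sum_eq_zero_iff_of_nonneg fun i _ => Finset.sum_nonneg fun j _ => sq_nonneg _]
  constructor
  · intro h i j hij
    have := (Finset.sum_eq_zero_iff_of_nonneg fun j _ => sq_nonneg _).mp
      (h i (Finset.mem_univ i)) j (Finset.mem_univ j)
    simpa [(hα i j hij).det_pair_ne_zero] using this
  · intro h i _
    refine Finset.sum_eq_zero fun j _ => ?_
    by_cases hij : i = j
    -- Diagonal terms vanish through the `α` factor, so they put no constraint on `ψ i`.
    · subst hij; simp [mul_comm]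
    · simp [h i j hij]

/-! ### Normal form under local operations -/

theorem IsEntangledVector.det_ne_zero {v : Fin 2 × Fin 2 → ℂ} (hv : IsEntangledVector v) :
    v (0, 0) * v (1, 1) - v (0, 1) * v (1, 0) ≠ 0 := by
  intro h
  apply hv
  by_cases h0 : v (0, 0) = 0
  · rw [h0, zero_mul, zero_sub, neg_eq_zero, mul_eq_zero] at h
    rcases h with h | h
    · exact ⟨![0, 1], fun c => v (1, c), by rintro ⟨i, j⟩; fin_cases i <;> fin_cases j <;> simp [*]⟩
    · exact ⟨fun b => v (b, 1), ![0, 1], by rintro ⟨i, j⟩; fin_cases i <;> fin_cases j <;> simp [*]⟩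
  · refine ⟨![1, v (1, 0) / v (0, 0)], fun c => v (0, c), ?_⟩
    rintro ⟨i, j⟩
    fin_cases i <;> fin_cases j <;> simp <;> field_simp
    linear_combination h

theorem polarDet_kronecker_mulVec (P Q : Matrix (Fin 2) (Fin 2) ℂ) (v w : Fin 2 × Fin 2 → ℂ) :
    polarDet ((P ⊗ₖ Q) *ᵥ v) ((P ⊗ₖ Q) *ᵥ w) = P.det * Q.det * polarDet v w := by
  simp only [polarDet, mulVec, dotProduct, Fintype.sum_prod_type, Fin.sum_univ_two,
    kroneckerMap_apply, det_fin_two]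
  ring

/-- The polarized determinant on `2 × 2` matrices. -/
def polarDetMatrix (A B : Matrix (Fin 2) (Fin 2) ℂ) : ℂ :=
  A 0 0 * B 1 1 + A 1 1 * B 0 0 - A 0 1 * B 1 0 - A 1 0 * B 0 1

theorem polarDetMatrix_mul_mul (S T A B : Matrix (Fin 2) (Fin 2) ℂ) :
    polarDetMatrix (S * A * T) (S * B * T) = S.det * T.det * polarDetMatrix A B := by
  simp only [polarDetMatrix, mul_apply, Fin.sum_univ_two, det_fin_two]
  ring

/-- By Cayley–Hamilton `N² = l²` with `l² = -det N ≠ 0`, so the eigenvalues `±l` are distinct. The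
rows of `S` are left eigenvectors: the first row of `N + l` and the second row of `l - N`. -/
theorem exists_diagonalize_traceless (N : Matrix (Fin 2) (Fin 2) ℂ)
    (htr : N 0 0 + N 1 1 = 0) (hdet : N.det ≠ 0) :
    ∃ S : Matrix (Fin 2) (Fin 2) ℂ, IsUnit S ∧ ∃ l : ℂ, l ≠ 0 ∧
      S * N * S⁻¹ = l • !![1, 0; 0, -1] := by
  have hd : N 1 1 = -N 0 0 := by linear_combination htr
  -- The sign of the root is chosen to keep `det S = 2 l (N 0 0 + l)` nonzero.
  obtain ⟨l, hl, hla⟩ : ∃ l : ℂ, l ^ 2 = -N.det ∧ N 0 0 + l ≠ 0 := by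
    obtain ⟨l, hl⟩ := IsAlgClosed.exists_pow_nat_eq (-N.det) two_pos
    by_cases h : N 0 0 + l = 0
    · refine ⟨-l, by rw [← hl]; ring, fun h' => hdet ?_⟩
      have : l = 0 := by linear_combination (h - h') / 2
      simpa [this] using hl
    · exact ⟨l, hl, h⟩
  have hl0 : l ≠ 0 := by rintro rfl; apply hdet; simpa using hl.symm
  rw [det_fin_two, hd] at hl
  have hS : IsUnit (!![N 0 0 + l, N 0 1; -N 1 0, N 0 0 + l] : Matrix (Fin 2) (Fin 2) ℂ).det := by
    rw [isUnit_iff_ne_zero, det_fin_two_of]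
    have : (N 0 0 + l) * (N 0 0 + l) - N 0 1 * -N 1 0 = 2 * l * (N 0 0 + l) := by
      linear_combination -hl
    rw [this]
    exact mul_ne_zero (mul_ne_zero two_ne_zero hl0) hla
  refine ⟨_, (isUnit_iff_isUnit_det _).mpr hS, l, hl0, ?_⟩
  have h : !![N 0 0 + l, N 0 1; -N 1 0, N 0 0 + l] * N
      = l • !![1, 0; 0, -1] * !![N 0 0 + l, N 0 1; -N 1 0, N 0 0 + l] := by
    ext i j
    fin_cases i <;> fin_cases j <;> simp [mul_apply, Fin.sum_univ_two, hd] <;>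
      first | ring1 | linear_combination -hl | linear_combination hl
  rw [h, mul_nonsing_inv_cancel_right _ _ hS]

/-- Send `M 0` to the identity. Orthogonality to it means trace zero, so `M 1` can be diagonalized;
the other two are then off-diagonal. -/
theorem exists_equivalent_bell (M : Fin 4 → Matrix (Fin 2) (Fin 2) ℂ)
    (hdet : ∀ i, (M i).det ≠ 0) (horth : ∀ i j, i ≠ j → polarDetMatrix (M i) (M j) = 0) :
    ∃ P Q : Matrix (Fin 2) (Fin 2) ℂ, IsUnit P ∧ IsUnit Q ∧ ∃ d : Fin 4 → ℂ, (∀ i, d i ≠ 0) ∧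
      ∀ i, P * M i * Q =
        d i • ![!![1, 0; 0, 1], !![1, 0; 0, -1], !![0, 1; 1, 0], !![0, 1; -1, 0]] i := by
  have hM0 : IsUnit (M 0).det := isUnit_iff_ne_zero.mpr (hdet 0)
  have hM0i : ((M 0)⁻¹).det ≠ 0 := (isUnit_nonsing_inv_det _ hM0).ne_zero
  obtain ⟨S, hS, l, hl, hN1⟩ := exists_diagonalize_traceless ((M 0)⁻¹ * M 1)
    (by
      have h := polarDetMatrix_mul_mul (M 0)⁻¹ 1 (M 0) (M 1)
      rw [horth 0 1 (by decide), mul_zero, Matrix.mul_one, Matrix.mul_one,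
        nonsing_inv_mul _ hM0] at h
      simp only [polarDetMatrix, one_apply] at h
      simpa [add_comm] using h)
    (by rw [det_mul]; exact mul_ne_zero hM0i (hdet 1))
  have hSd : IsUnit S.det := (isUnit_iff_isUnit_det _).mp hS
  have hSi : IsUnit (S⁻¹).det := isUnit_nonsing_inv_det _ hSd
  set N : Fin 4 → Matrix (Fin 2) (Fin 2) ℂ := fun i => S * (M 0)⁻¹ * M i * S⁻¹ with hN
  have hN0 : N 0 = 1 := by
    simp only [hN]
    rw [nonsing_inv_mul_cancel_right _ _ hM0, mul_nonsing_inv _ hSd]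
  have hN1 : N 1 = l • !![1, 0; 0, -1] := by
    rw [← hN1]; simp only [hN, Matrix.mul_assoc]
  have hNorth : ∀ i j, i ≠ j → polarDetMatrix (N i) (N j) = 0 := fun i j hij => by
    simp only [hN, polarDetMatrix_mul_mul, horth i j hij, mul_zero]
  have hNdet : ∀ i, (N i).det ≠ 0 := fun i => by
    simp only [hN, det_mul]
    exact mul_ne_zero (mul_ne_zero (mul_ne_zero hSd.ne_zero hM0i) (hdet i)) hSi.ne_zero
  have hoff : ∀ i, i ≠ 0 → i ≠ 1 → N i 0 0 = 0 ∧ N i 1 1 = 0 := by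
    intro i h0 h1
    have e0 := hNorth 0 i h0.symm
    have e1 := hNorth 1 i h1.symm
    simp [hN0, polarDetMatrix] at e0
    simp [hN1, polarDetMatrix] at e1
    have e2 : N i 1 1 - N i 0 0 = 0 := mul_left_cancel₀ hl (by linear_combination e1)
    exact ⟨by linear_combination (e0 - e2) / 2, by linear_combination (e0 + e2) / 2⟩
  obtain ⟨h200, h211⟩ := hoff 2 (by decide) (by decide)
  obtain ⟨h300, h311⟩ := hoff 3 (by decide) (by decide)
  have hd2 := hNdet 2
  have hd3 := hNdet 3
  have h23 := hNorth 2 3 (by decide)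
  rw [det_fin_two, h200, zero_mul, zero_sub, neg_ne_zero, mul_ne_zero_iff] at hd2
  rw [det_fin_two, h300, zero_mul, zero_sub, neg_ne_zero, mul_ne_zero_iff] at hd3
  rw [polarDetMatrix, h200, h211, zero_mul, zero_mul] at h23
  -- Conjugation by `diag(s, 1)` multiplies entry `0 1` by `s` and divides entry `1 0` by `s`; this
  -- `s` makes `N 2` symmetric. Orthogonality to `N 2` then makes `N 3` antisymmetric.
  obtain ⟨s, hs⟩ := IsAlgClosed.exists_pow_nat_eq (N 2 1 0 / N 2 0 1) two_pos
  have hs0 : s ≠ 0 := by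
    rintro rfl
    exact div_ne_zero hd2.2 hd2.1 (by simpa using hs.symm)
  have hs2 : N 2 1 0 = s ^ 2 * N 2 0 1 := by rw [hs, div_mul_cancel₀ _ hd2.1]
  have hs3 : N 3 1 0 = -(s ^ 2 * N 3 0 1) := by
    apply mul_left_cancel₀ hd2.1
    rw [hs2] at h23
    linear_combination -h23
  have key : ∀ i, !![s, 0; 0, 1] * (S * (M 0)⁻¹) * M i * (S⁻¹ * !![s⁻¹, 0; 0, 1])
      = !![s, 0; 0, 1] * N i * !![s⁻¹, 0; 0, 1] := fun i => by
    simp only [hN, Matrix.mul_assoc]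
  refine ⟨!![s, 0; 0, 1] * (S * (M 0)⁻¹), S⁻¹ * !![s⁻¹, 0; 0, 1], ?_, ?_,
    ![1, l, s * N 2 0 1, s * N 3 0 1], ?_, ?_⟩
  · rw [isUnit_iff_isUnit_det, isUnit_iff_ne_zero, det_mul, det_mul, det_fin_two_of]
    simpa using ⟨hs0, hSd.ne_zero, hdet 0⟩
  · rw [isUnit_iff_isUnit_det, isUnit_iff_ne_zero, det_mul, det_fin_two_of]
    simpa using ⟨hSd.ne_zero, hs0⟩
  · intro i
    fin_cases i <;> simp [hl, hs0, hd2.1, hd3.1]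
  · intro i
    rw [key]
    fin_cases i
    · ext i j
      fin_cases i <;> fin_cases j <;> simp [hN0, mul_apply, Fin.sum_univ_two, hs0]
    · ext i j
      fin_cases i <;> fin_cases j <;> simp [hN1, mul_apply, Fin.sum_univ_two]
      field_simp
    · have h2 : N 2 = !![0, N 2 0 1; s ^ 2 * N 2 0 1, 0] := by
        conv_lhs => rw [eta_fin_two (N 2), h200, h211, hs2]
      generalize N 2 0 1 = b at h2
      ext i j
      fin_cases i <;> fin_cases j <;> simp [h2, mul_apply, Fin.sum_univ_two]
      field_simp
    · have h3 : N 3 = !![0, N 3 0 1; -(s ^ 2 * N 3 0 1), 0] := by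
        conv_lhs => rw [eta_fin_two (N 3), h300, h311, hs3]
      generalize N 3 0 1 = b at h3
      ext i j
      fin_cases i <;> fin_cases j <;> simp [h3, mul_apply, Fin.sum_univ_two]
      field_simp

theorem kronecker_mulVec_apply (P Q : Matrix (Fin 2) (Fin 2) ℂ) (v : Fin 2 × Fin 2 → ℂ)
    (s : Fin 2 × Fin 2) :
    ((P ⊗ₖ Q) *ᵥ v) s = (P * Matrix.of (fun a b => v (a, b)) * Qᵀ) s.1 s.2 := by
  simp only [mulVec, dotProduct, Fintype.sum_prod_type, Fin.sum_univ_two, kroneckerMap_apply,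
    mul_apply, transpose_apply, of_apply]
  ring

theorem mul_columnMatrix_mul_diagonal_apply (K : Matrix (Fin 2 × Fin 2) (Fin 2 × Fin 2) ℂ)
    (ψ : Fin 4 → Fin 2 × Fin 2 → ℂ) (d : Fin 4 → ℂ) (s : Fin 2 × Fin 2) (j : Fin 4) :
    (K * columnMatrix ψ * diagonal d) s j = (K *ᵥ ψ j) s * d j := by
  rw [mul_diagonal]
  rfl

theorem bellMatrix_apply (s : Fin 2 × Fin 2) (j : Fin 4) :
    bellMatrix s j = (![!![1, 0; 0, 1], !![1, 0; 0, -1], !![0, 1; 1, 0], !![0, 1; -1, 0]] j :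
      Matrix (Fin 2) (Fin 2) ℂ) s.1 s.2 := by
  obtain ⟨a, b⟩ := s
  fin_cases a <;> fin_cases b <;> fin_cases j <;> simp [bellMatrix, finProdFinEquiv]

theorem polarDet_bellMatrix {i j : Fin 4} (hij : i ≠ j) :
    polarDet (fun s => bellMatrix s i) (fun s => bellMatrix s j) = 0 := by
  simp only [polarDet, bellMatrix_apply]
  fin_cases i <;> fin_cases j <;> simp at hij ⊢

theorem polarDet_mul_right (v w : Fin 2 × Fin 2 → ℂ) (c d : ℂ) :
    polarDet (fun s => v s * c) (fun s => w s * d) = c * d * polarDet v w := by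
  simp only [polarDet]
  ring

theorem mainTheorem4 (ρ : QubitMatrix 3) (hρ : IsPPTEntangled ρ) (hrank : ρ.rank = 4)
    (π : Equiv.Perm (Fin 3)) (α : Fin 4 → Fin 2 → ℂ) (ψ : Fin 4 → Fin 2 × Fin 2 → ℂ)
    (hform : ρ = biproductSum π α ψ)
    (hα : ∀ i j, i ≠ j → LinearIndependent ℂ ![α i, α j])
    (hψ : LinearIndependent ℂ ψ)
    (hent : ∀ i, IsEntangledVector (ψ i)) :
    lorentzInvariant ρ = 0 ↔
      ∃ (P Q : Matrix (Fin 2) (Fin 2) ℂ) (D : Matrix (Fin 4) (Fin 4) ℂ),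
        IsUnit P ∧ IsUnit Q ∧ D.IsDiag ∧ IsUnit D ∧
          (P ⊗ₖ Q) * columnMatrix ψ * D = bellMatrix := by
  rw [hform, lorentzInvariant_eq_zero_iff π α ψ hα]
  constructor
  · intro h
    obtain ⟨P, Q, hP, hQ, d, hd, hPQ⟩ := exists_equivalent_bell
      (fun i => Matrix.of fun a b => ψ i (a, b))
      (fun i => by rw [det_fin_two]; exact (hent i).det_ne_zero)
      (fun i j hij => h i j hij)
    -- The transpose offsets the one in `M ↦ P M Qᵀ`; `D` removes the scalars `d i`.
    refine ⟨P, Qᵀ, diagonal fun i => (d i)⁻¹, hP, (isUnit_transpose Q).mpr hQ, isDiag_diagonal _, ?_, ?_⟩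
    · rw [isUnit_diagonal, Pi.isUnit_iff]
      exact fun i => isUnit_iff_ne_zero.mpr (inv_ne_zero (hd i))
    · ext s j
      rw [mul_columnMatrix_mul_diagonal_apply, kronecker_mulVec_apply, transpose_transpose, hPQ,
        bellMatrix_apply, Matrix.smul_apply, smul_eq_mul, mul_right_comm, mul_inv_cancel₀ (hd j), one_mul]
  · rintro ⟨P, Q, D, hP, hQ, hD, hDu, h⟩ i j hij
    rw [← hD.diagonal_diag] at h hDu
    have hd : ∀ k, D.diag k ≠ 0 := fun k =>
      isUnit_iff_ne_zero.mp (Pi.isUnit_iff.mp (isUnit_diagonal.mp hDu) k)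
    have hbell := polarDet_bellMatrix hij
    simp only [← h, mul_columnMatrix_mul_diagonal_apply] at hbell
    rw [polarDet_mul_right, polarDet_kronecker_mulVec] at hbell
    have hP' := ((isUnit_iff_isUnit_det P).mp hP).ne_zero
    have hQ' := ((isUnit_iff_isUnit_det Q).mp hQ).ne_zero
    exact (mul_eq_zero.mp ((mul_eq_zero.mp hbell).resolve_left (mul_ne_zero (hd i) (hd j)))
      ).resolve_left (mul_ne_zero hP' hQ')
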